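/- Let $N$ and $n$ be positive integers, and let $V=(v_{ij})_{1\le i,j\le N}$ be an $N\times N$ circular orthogonal ensemble (COE) matrix, that is, a random matrix with the same distribution as $U^{\mathsf T}U$, where $U$ is distributed according to the Haar probability measure on the unitary group $U(N)$ and $U^{\mathsf T}$ denotes the transpose of $U$. Then for every $1\le i\le N$, $$ \mathbb{E}\bigl[|v_{ii}|^{2n}\bigr]=\frac{2^n\, n!}{\prod_{k=1}^{n}(N+2k-1)}=\frac{2^n\, n!}{(N+1)(N+3)\cdots(N+2n-1)}. $$ -/

import Mathlib

open MeasureTheory ProbabilityTheory Matrix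

noncomputable section

/-- Complex `N × N` matrices carry the Borel `σ`-algebra of the entrywise topology. -/
instance coeMatrixMeasurableSpace (N : ℕ) : MeasurableSpace (Matrix (Fin N) (Fin N) ℂ) :=
  borel _

instance coeMatrixBorelSpace (N : ℕ) : BorelSpace (Matrix (Fin N) (Fin N) ℂ) := ⟨rfl⟩

/-- The unitary group `U(N)` is compact. -/
instance unitaryGroupCompactSpace (N : ℕ) : CompactSpace (unitaryGroup (Fin N) ℂ) := by
  have hc : IsClosed {A : Matrix (Fin N) (Fin N) ℂ | A * star A = 1} :=
    isClosed_eq (by fun_prop) continuous_const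
  have hb : IsCompact (Set.univ.pi fun _ : Fin N => Set.univ.pi fun _ : Fin N =>
      Metric.closedBall (0 : ℂ) 1) :=
    isCompact_univ_pi fun _ => isCompact_univ_pi fun _ => isCompact_closedBall _ _
  have hk : IsCompact {A : Matrix (Fin N) (Fin N) ℂ | A * star A = 1} := by
    refine IsCompact.of_isClosed_subset hb hc ?_
    intro A hA i _ j _
    simpa using entry_norm_bound_of_unitary (mem_unitaryGroup_iff.2 hA) i j
  have he : ((unitaryGroup (Fin N) ℂ : Submonoid (Matrix (Fin N) (Fin N) ℂ)) :
      Set (Matrix (Fin N) (Fin N) ℂ)) = {A | A * star A = 1} := by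
    ext A
    exact mem_unitaryGroup_iff
  exact isCompact_iff_compactSpace.1 (he ▸ hk)

/-- The Haar probability measure on the unitary group `U(N)` (the circular unitary ensemble). -/
def haarUnitary (N : ℕ) : Measure (unitaryGroup (Fin N) ℂ) :=
  Measure.haarMeasure ⊤

instance haarUnitary_isProbabilityMeasure (N : ℕ) : IsProbabilityMeasure (haarUnitary N) :=
  ⟨by simpa [haarUnitary] using
    Measure.haarMeasure_self (K₀ := (⊤ : TopologicalSpace.PositiveCompacts
      (unitaryGroup (Fin N) ℂ)))⟩

/-- The circular orthogonal ensemble of size `N`, as a law on complex `N × N` matrices: the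
distribution of `Uᵀ U` where `U` is a Haar-distributed unitary matrix. -/
def coeLaw (N : ℕ) : Measure (Matrix (Fin N) (Fin N) ℂ) :=
  (haarUnitary N).map fun U : unitaryGroup (Fin N) ℂ => (U : Matrix (Fin N) (Fin N) ℂ)ᵀ * (U : Matrix (Fin N) (Fin N) ℂ)

theorem measurable_transpose_mul_self (N : ℕ) :
    Measurable fun U : unitaryGroup (Fin N) ℂ =>
      (U : Matrix (Fin N) (Fin N) ℂ)ᵀ * (U : Matrix (Fin N) (Fin N) ℂ) :=
  Continuous.measurable (by fun_prop)

instance coeLaw_isProbabilityMeasure (N : ℕ) : IsProbabilityMeasure (coeLaw N) :=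
  Measure.isProbabilityMeasure_map (measurable_transpose_mul_self N).aemeasurable

/-- The circular orthogonal ensemble is invariant under `V ↦ U₀ᵀ V U₀` for unitary `U₀`. -/
theorem coeLaw_map_congr (N : ℕ) (U₀ : unitaryGroup (Fin N) ℂ) :
    (coeLaw N).map (fun V => (U₀ : Matrix (Fin N) (Fin N) ℂ)ᵀ * V * (U₀ : Matrix (Fin N) (Fin N) ℂ))
      = coeLaw N := by
  have h : (haarUnitary N).map (fun U => U * U₀) = haarUnitary N := by
    have : IsProbabilityMeasure ((haarUnitary N).map fun U => U * U₀) :=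
      Measure.isProbabilityMeasure_map (by fun_prop)
    have : (haarUnitary N).IsHaarMeasure := by unfold haarUnitary; infer_instance
    exact Measure.isHaarMeasure_eq_of_isProbabilityMeasure _ _
  conv_rhs => rw [coeLaw, ← h]
  rw [coeLaw, Measure.map_map (Continuous.measurable (by fun_prop))
    (measurable_transpose_mul_self N), Measure.map_map (measurable_transpose_mul_self N)
    (Continuous.measurable (by fun_prop))]
  congr 1
  funext U
  simp [Matrix.mul_assoc]

end

/-! With `V = UᵀU`, the entry `v_ii` is `∑ k, u_ki ^ 2`, and its `n`-th power expands into monomials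
`u^(2a)` with `|a| = n`. Diagonal unitaries make distinct monomials orthogonal, so the moment is `∑
multinomial(a)² E|u^(2a)|²`.

Full left invariance makes `E|∑ w_k u_ki|^(2m)` depend only on `‖w‖`. Comparing coefficients shows
that `multinomial(a) E|u^a|²` is the same for all `|a| = m`. Since `∑ |u_ki|² = 1`, this constant is
`1 / N.multichoose m`.

Taking `m = 2n`, what remains is a sum of products of central binomials, a coefficient of `(1 -
4X)^(-N/2)`. It contributes `N(N+2)⋯(N+2n-2)`, which cancels the even-offset factors of
`N(N+1)⋯(N+2n-1)` and leaves the odd ones. -/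

/-! ### Combinatorics of compositions and central binomials. -/

theorem sum_piAntidiag_eq_sum_finsuppAntidiag {ι R : Type*} [Fintype ι] [DecidableEq ι]
    [AddCommMonoid R] (n : ℕ) (f : (ι → ℕ) → R) :
    ∑ a ∈ Finset.piAntidiag Finset.univ n, f a
      = ∑ a ∈ Finset.finsuppAntidiag (Finset.univ : Finset ι) n, f a := by
  refine Finset.sum_nbij' Finsupp.equivFunOnFinite.symm (fun a => ⇑a) ?_ ?_ ?_ ?_ ?_ <;>
    simp [Finset.mem_finsuppAntidiag]

theorem card_piAntidiag_univ_fin (N n : ℕ) :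
    (Finset.piAntidiag (Finset.univ : Finset (Fin N)) n).card = N.multichoose n := by
  rw [Finset.card_eq_sum_ones, sum_piAntidiag_eq_sum_finsuppAntidiag, ← Finset.card_eq_sum_ones,
    Finset.card_finsuppAntidiag_nat_eq_multichoose, Finset.card_univ, Fintype.card_fin]

theorem factorial_mul_multichoose (N n : ℕ) :
    n.factorial * N.multichoose n = N.ascFactorial n := by
  rw [Nat.multichoose_eq]
  rw [Nat.ascFactorial_eq_factorial_mul_choose']

open PowerSeries in
/-- The generating function `A` of the central binomial coefficients satisfies
`A' = 2 A + 4 X A'`. -/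
theorem derivative_mk_centralBinom :
    derivative ℚ (mk fun n => (n.centralBinom : ℚ)) =
      2 * (mk fun n => (n.centralBinom : ℚ)) +
        4 * (X * derivative ℚ (mk fun n => (n.centralBinom : ℚ))) := by
  ext n
  rw [map_add, ← map_ofNat (C (R := ℚ)) 2, ← map_ofNat (C (R := ℚ)) 4, coeff_C_mul, coeff_C_mul]
  have h : ((n : ℚ) + 1) * (n + 1).centralBinom = 2 * (2 * n + 1) * n.centralBinom :=
    mod_cast Nat.succ_mul_centralBinom_succ n
  cases n with
  | zero =>
    have h1 : Nat.centralBinom 1 = 2 := rfl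
    simp [coeff_derivative, h1]
  | succ n =>
    simp only [coeff_succ_X_mul, coeff_derivative, coeff_mk]
    push_cast at h ⊢
    linear_combination h

open PowerSeries in
theorem derivative_mk_centralBinom_pow (N : ℕ) :
    derivative ℚ ((mk fun n => (n.centralBinom : ℚ)) ^ N) =
      2 * (N : ℚ⟦X⟧) * (mk fun n => (n.centralBinom : ℚ)) ^ N +
        4 * (X * derivative ℚ ((mk fun n => (n.centralBinom : ℚ)) ^ N)) := by
  cases N with
  | zero => simp
  | succ N =>
    have h := derivative_mk_centralBinom
    rw [Derivation.leibniz_pow]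
    simp only [nsmul_eq_mul, smul_eq_mul, Nat.add_sub_cancel]
    linear_combination ((N + 1 : ℕ) : ℚ⟦X⟧) * (mk fun n => (n.centralBinom : ℚ)) ^ N * h

open PowerSeries in
-- The differential equation for the `N`-th power gives `(n+1) c_(n+1) = (2N+4n) c_n` for its
-- coefficients.
theorem coeff_mk_centralBinom_pow (N n : ℕ) :
    (n.factorial : ℚ) * coeff n ((mk fun n => (n.centralBinom : ℚ)) ^ N) =
      2 ^ n * ∏ k ∈ Finset.range n, ((N : ℚ) + 2 * k) := by
  induction n with
  | zero => simp
  | succ n ih =>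
    have h := congrArg (coeff n) (derivative_mk_centralBinom_pow N)
    rw [map_add, ← map_ofNat (C (R := ℚ)) 2, ← map_natCast (C (R := ℚ)) N, ← map_mul,
      ← map_ofNat (C (R := ℚ)) 4, coeff_C_mul, coeff_C_mul] at h
    have h' : ((n : ℚ) + 1) * coeff (n + 1) ((mk fun n => (n.centralBinom : ℚ)) ^ N) =
        (2 * N + 4 * n) * coeff n ((mk fun n => (n.centralBinom : ℚ)) ^ N) := by
      cases n with
      | zero =>
        simp only [coeff_derivative, coeff_zero_X_mul] at h
        push_cast at h ⊢
        linear_combination h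
      | succ n =>
        simp only [coeff_succ_X_mul, coeff_derivative] at h
        push_cast at h ⊢
        linear_combination h
    rw [Nat.factorial_succ, Finset.prod_range_succ]
    push_cast
    linear_combination (n.factorial : ℚ) * h' + (2 * N + 4 * n) * ih

theorem sum_prod_centralBinom (N n : ℕ) :
    (n.factorial : ℝ) * ∑ a ∈ Finset.piAntidiag (Finset.univ : Finset (Fin N)) n,
        ∏ k, ((a k).centralBinom : ℝ) =
      2 ^ n * ∏ k ∈ Finset.range n, ((N : ℝ) + 2 * k) := by
  have h := coeff_mk_centralBinom_pow N n
  have e : PowerSeries.coeff n ((PowerSeries.mk fun n => (n.centralBinom : ℚ)) ^ N) =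
      ∑ a ∈ Finset.piAntidiag (Finset.univ : Finset (Fin N)) n,
        ∏ k, ((a k).centralBinom : ℚ) := by
    rw [sum_piAntidiag_eq_sum_finsuppAntidiag (f := fun a => ∏ k, ((a k).centralBinom : ℚ))]
    simpa using PowerSeries.coeff_prod
      (fun _ : Fin N => PowerSeries.mk fun n => (n.centralBinom : ℚ)) n Finset.univ
  rw [e] at h
  exact_mod_cast congrArg (Rat.cast : ℚ → ℝ) h

theorem ascFactorial_two_mul_eq (N n : ℕ) :
    ((N.ascFactorial (2 * n) : ℕ) : ℝ) =
      (∏ k ∈ Finset.range n, ((N : ℝ) + 2 * k)) *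
        ∏ k ∈ Finset.Icc 1 n, ((N : ℝ) + 2 * (k : ℝ) - 1) := by
  induction n with
  | zero => simp
  | succ n ih =>
    rw [Finset.prod_range_succ, Finset.prod_Icc_succ_top (by omega), Nat.mul_succ,
      Nat.ascFactorial_succ, Nat.ascFactorial_succ]
    push_cast
    rw [ih]
    ring

/-! ### Moments of a column of a Haar unitary matrix. -/

noncomputable section

instance haarUnitary_isHaarMeasure (N : ℕ) : (haarUnitary N).IsHaarMeasure := by
  unfold haarUnitary; infer_instance

theorem integrable_haarUnitary_of_continuous {N : ℕ} {E : Type*} [NormedAddCommGroup E]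
    {f : unitaryGroup (Fin N) ℂ → E} (hf : Continuous f) :
    Integrable f (haarUnitary N) :=
  hf.integrable_of_hasCompactSupport (HasCompactSupport.of_compactSpace f)

theorem continuous_unitaryGroup_apply {N : ℕ} (k i : Fin N) :
    Continuous fun U : unitaryGroup (Fin N) ℂ => (U : Matrix (Fin N) (Fin N) ℂ) k i :=
  continuous_subtype_val.matrix_elem k i

/-- The monomial with exponents `a` in the entries of column `i`. -/
def columnMonomial {N : ℕ} (i : Fin N) (a : Fin N → ℕ) (U : unitaryGroup (Fin N) ℂ) : ℂ :=
  ∏ k, (U : Matrix (Fin N) (Fin N) ℂ) k i ^ a k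

theorem continuous_columnMonomial {N : ℕ} (i : Fin N) (a : Fin N → ℕ) :
    Continuous (columnMonomial i a) :=
  continuous_finsetProd _ fun k _ => (continuous_unitaryGroup_apply k i).pow _

theorem columnMonomial_diagonal_mul {N : ℕ} (i : Fin N) (a : Fin N → ℕ) (d : Fin N → ℂ)
    (hd : diagonal d ∈ unitaryGroup (Fin N) ℂ) (U : unitaryGroup (Fin N) ℂ) :
    columnMonomial i a (⟨diagonal d, hd⟩ * U) = (∏ k, d k ^ a k) * columnMonomial i a U := by
  simp [columnMonomial, mul_pow, Finset.prod_mul_distrib]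

theorem exists_norm_one_pow_mul_star_pow_ne_one {a b : ℕ} (h : a ≠ b) :
    ∃ z : ℂ, z * star z = 1 ∧ z ^ a * star z ^ b ≠ 1 := by
  wlog hab : b < a generalizing a b
  · obtain ⟨z, hz, hz'⟩ := this h.symm (by omega)
    refine ⟨star z, by simpa [mul_comm] using hz, ?_⟩
    rwa [star_star, mul_comm]
  obtain ⟨c, rfl⟩ := Nat.exists_eq_add_of_lt hab
  have hz : ∀ x : ℝ, Complex.exp (x * Complex.I) * star (Complex.exp (x * Complex.I)) = 1 := by
    intro x
    rw [Complex.star_def, Complex.mul_conj, Complex.normSq_eq_norm_sq,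
      Complex.norm_exp_ofReal_mul_I]
    simp
  -- Here `a - b = c + 1`, so this `z` has `z ^ (a - b) = exp (π i) = -1`.
  refine ⟨Complex.exp ((Real.pi / (c + 1) : ℝ) * Complex.I), hz _, ?_⟩
  rw [add_assoc, add_comm b, pow_add, mul_assoc, ← mul_pow, hz, one_pow, mul_one,
    ← Complex.exp_nat_mul]
  have : ((c + 1 : ℕ) : ℂ) * ((Real.pi / (c + 1) : ℝ) * Complex.I) = Real.pi * Complex.I := by
    have : (c : ℂ) + 1 ≠ 0 := by exact_mod_cast c.succ_ne_zero
    push_cast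
    field_simp
  rw [this, Complex.exp_pi_mul_I]
  norm_num

/-- Multiplying one row `j` with `a j ≠ b j` by a phase preserves Haar measure but scales the
integrand by a factor other than `1`. -/
theorem integral_columnMonomial_mul_star_eq_zero {N : ℕ} (i : Fin N) {a b : Fin N → ℕ}
    (h : a ≠ b) :
    ∫ U, columnMonomial i a U * star (columnMonomial i b U) ∂haarUnitary N = 0 := by
  obtain ⟨j, hj⟩ := Function.ne_iff.1 h
  obtain ⟨z, hz, hz'⟩ := exists_norm_one_pow_mul_star_pow_ne_one hj
  have hd : diagonal (Function.update 1 j z) ∈ unitaryGroup (Fin N) ℂ := by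
    rw [mem_unitaryGroup_iff, star_eq_conjTranspose, diagonal_conjTranspose, diagonal_mul_diagonal,
      ← diagonal_one]
    congr 1
    ext k
    rcases eq_or_ne k j with rfl | hk
    · simpa using hz
    · simp [hk]
  have hp : ∀ c : Fin N → ℕ, ∏ k, (Function.update 1 j z : Fin N → ℂ) k ^ c k = z ^ c j := by
    intro c
    rw [Finset.prod_eq_single j] <;> simp +contextual
  have hi := integral_mul_left_eq_self (μ := haarUnitary N)
    (fun U => columnMonomial i a U * star (columnMonomial i b U)) ⟨_, hd⟩
  simp only [columnMonomial_diagonal_mul, hp, star_mul'] at hi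
  have hc : ∀ U, z ^ a j * columnMonomial i a U * (star (z ^ b j) * star (columnMonomial i b U)) =
      z ^ a j * star z ^ b j * (columnMonomial i a U * star (columnMonomial i b U)) := fun U => by
    rw [mul_mul_mul_comm, star_pow]
  simp only [hc, integral_const_mul] at hi
  have : (z ^ a j * star z ^ b j - 1) *
      ∫ U, columnMonomial i a U * star (columnMonomial i b U) ∂haarUnitary N = 0 := by
    rw [sub_mul, hi, one_mul, sub_self]
  exact (mul_eq_zero.1 this).resolve_left (sub_ne_zero.2 hz')

/-- The mean square of a monomial in the entries of column `i`. -/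
def columnMoment {N : ℕ} (i : Fin N) (a : Fin N → ℕ) : ℝ :=
  ∫ U, ‖columnMonomial i a U‖ ^ 2 ∂haarUnitary N

/-- Pythagoras for linear combinations of distinct monomials in the entries of a column. -/
theorem integral_norm_sq_sum_columnMonomial {N : ℕ} {ι : Type*} (i : Fin N) (S : Finset ι)
    (e : ι → Fin N → ℕ) (he : Function.Injective e) (c : ι → ℂ) :
    ∫ U, ‖∑ s ∈ S, c s * columnMonomial i (e s) U‖ ^ 2 ∂haarUnitary N =
      ∑ s ∈ S, ‖c s‖ ^ 2 * columnMoment i (e s) := by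
  have hsq : ∀ z : ℂ, ((‖z‖ ^ 2 : ℝ) : ℂ) = z * star z := fun z => by
    rw [Complex.star_def, Complex.mul_conj, Complex.normSq_eq_norm_sq]
  have hint : ∀ s t, Integrable (fun U => (c s * star (c t)) *
      (columnMonomial i (e s) U * star (columnMonomial i (e t) U))) (haarUnitary N) := fun s t =>
    integrable_haarUnitary_of_continuous (continuous_const.mul
      ((continuous_columnMonomial i _).mul (continuous_columnMonomial i _).star))
  apply Complex.ofReal_injective
  rw [← integral_complex_ofReal]
  simp only [hsq, star_sum, star_mul', Finset.sum_mul_sum]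
  have hc : ∀ s t U, c s * columnMonomial i (e s) U * (star (c t) * star (columnMonomial i (e t) U))
      = (c s * star (c t)) * (columnMonomial i (e s) U * star (columnMonomial i (e t) U)) :=
    fun s t U => mul_mul_mul_comm _ _ _ _
  simp only [hc]
  rw [integral_finsetSum _ fun s _ => integrable_finsetSum _ fun t _ => hint s t, Complex.ofReal_sum]
  refine Finset.sum_congr rfl fun s hs => ?_
  rw [integral_finsetSum _ fun t _ => hint s t, Finset.sum_eq_single s]
  · rw [integral_const_mul, Complex.ofReal_mul, hsq, columnMoment, ← integral_complex_ofReal]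
    simp only [hsq]
  · intro t _ hts
    rw [integral_const_mul, integral_columnMonomial_mul_star_eq_zero i (he.ne hts.symm), mul_zero]
  · exact fun h => absurd hs h

theorem exists_unitary_row {N : ℕ} (j : Fin N) (v : Fin N → ℂ) (hv : ∑ k, ‖v k‖ ^ 2 = 1) :
    ∃ g : unitaryGroup (Fin N) ℂ, ∀ k, (g : Matrix (Fin N) (Fin N) ℂ) j k = v k := by
  let w : EuclideanSpace ℂ (Fin N) := WithLp.toLp 2 fun k => star (v k)
  have hw : ‖w‖ = 1 := by
    rw [EuclideanSpace.norm_eq, Real.sqrt_eq_one]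
    simpa [w] using hv
  obtain ⟨b, hb⟩ := Orthonormal.exists_orthonormalBasis_extension_of_card_eq (𝕜 := ℂ)
    (E := EuclideanSpace ℂ (Fin N)) (ι := Fin N) (by simp) (v := fun _ => w) (s := {j}) (by
      rw [orthonormal_iff_ite]
      rintro ⟨x, rfl⟩ ⟨y, rfl⟩
      simp [Set.domRestrict, hw])
  -- The inner product is conjugate-linear on the left, so with conjugated rows `⟪b x, b y⟫` is the
  -- `(x, y)` entry of `g * star g`.
  refine ⟨⟨Matrix.of fun x k => star (b x k), ?_⟩, fun k => ?_⟩
  · rw [mem_unitaryGroup_iff]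
    ext x y
    have := orthonormal_iff_ite.1 b.orthonormal x y
    rw [PiLp.inner_apply] at this
    simpa [Matrix.mul_apply, Matrix.one_apply, mul_comm] using this
  · simp [hb j rfl, w]

/-- By unitary invariance, the moments of a linear form in a column only depend on its norm. -/
theorem integral_norm_sum_mul_pow {N : ℕ} (i : Fin N) (w : Fin N → ℂ) (m : ℕ) :
    ∫ U : unitaryGroup (Fin N) ℂ,
        ‖∑ k, w k * (U : Matrix (Fin N) (Fin N) ℂ) k i‖ ^ (2 * m) ∂haarUnitary N =
      (∑ k, ‖w k‖ ^ 2) ^ m * ∫ U : unitaryGroup (Fin N) ℂ,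
        ‖(U : Matrix (Fin N) (Fin N) ℂ) i i‖ ^ (2 * m) ∂haarUnitary N := by
  set s := ∑ k, ‖w k‖ ^ 2 with hs
  have hs0 : 0 ≤ s := Finset.sum_nonneg fun k _ => sq_nonneg ‖w k‖
  rcases hs0.eq_or_lt with h0 | hpos
  · have hw : ∀ k, w k = 0 := by
      intro k
      have := (Finset.sum_eq_zero_iff_of_nonneg fun k _ => sq_nonneg ‖w k‖).1 (hs ▸ h0.symm) k
        (Finset.mem_univ k)
      simpa using this
    rw [← h0]
    cases m <;> simp [hw]
  have hr : 0 < √s := Real.sqrt_pos.2 hpos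
  obtain ⟨g, hg⟩ := exists_unitary_row i (fun k => w k / (√s : ℝ)) (by
    simp only [norm_div, div_pow, Complex.norm_real, Real.norm_eq_abs, sq_abs,
      Real.sq_sqrt hpos.le]
    rw [← Finset.sum_div, ← hs, div_self hpos.ne'])
  rw [← integral_mul_left_eq_self
    (fun U : unitaryGroup (Fin N) ℂ => ‖(U : Matrix (Fin N) (Fin N) ℂ) i i‖ ^ (2 * m)) g,
    ← integral_const_mul]
  congr 1
  ext U
  have : ((g * U : unitaryGroup (Fin N) ℂ) : Matrix (Fin N) (Fin N) ℂ) i i =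
      (∑ k, w k * (U : Matrix (Fin N) (Fin N) ℂ) k i) / (√s : ℝ) := by
    simp [Matrix.mul_apply, hg, Finset.sum_div, div_mul_eq_mul_div]
  rw [this, norm_div, Complex.norm_real, Real.norm_eq_abs, div_pow, pow_mul |√s|, sq_abs,
    Real.sq_sqrt hpos.le, mul_div_cancel₀ _ (pow_pos hpos m).ne']

/-- The moments of a diagonal entry of a Haar unitary matrix. -/
def entryMoment {N : ℕ} (i : Fin N) (m : ℕ) : ℝ :=
  ∫ U : unitaryGroup (Fin N) ℂ, ‖(U : Matrix (Fin N) (Fin N) ℂ) i i‖ ^ (2 * m) ∂haarUnitary N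

/-- Both sides compute `E|∑ √t_k u_ki|^(2m)`: by orthogonality of monomials, and by unitary
invariance. -/
theorem sum_multinomial_sq_mul_columnMoment {N : ℕ} (i : Fin N) (m : ℕ) (t : Fin N → ℝ)
    (ht : ∀ k, 0 ≤ t k) :
    ∑ a ∈ Finset.piAntidiag Finset.univ m,
        (Nat.multinomial Finset.univ a : ℝ) ^ 2 * columnMoment i a * ∏ k, t k ^ a k =
      ∑ a ∈ Finset.piAntidiag Finset.univ m,
        entryMoment i m * Nat.multinomial Finset.univ a * ∏ k, t k ^ a k := by
  have h := integral_norm_sum_mul_pow i (fun k => ((√(t k) : ℝ) : ℂ)) m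
  have h1 : ∀ U : unitaryGroup (Fin N) ℂ,
      ‖∑ k, ((√(t k) : ℝ) : ℂ) * (U : Matrix (Fin N) (Fin N) ℂ) k i‖ ^ (2 * m) =
      ‖∑ a ∈ Finset.piAntidiag Finset.univ m, ((Nat.multinomial Finset.univ a : ℂ) *
        ∏ k, ((√(t k) : ℝ) : ℂ) ^ a k) * columnMonomial i a U‖ ^ 2 := by
    intro U
    rw [mul_comm 2 m, pow_mul, ← norm_pow, Finset.sum_pow_eq_sum_piAntidiag]
    simp only [mul_pow, Finset.prod_mul_distrib, columnMonomial, mul_assoc]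
  simp only [h1] at h
  rw [integral_norm_sq_sum_columnMonomial i _ (fun a => a) Function.injective_id] at h
  simp only [Complex.norm_real, Real.norm_eq_abs, sq_abs, Real.sq_sqrt (ht _), norm_mul, norm_prod,
    norm_pow, mul_pow, ← Finset.prod_pow, pow_right_comm _ _ 2, Complex.norm_natCast,
    Finset.sum_pow_eq_sum_piAntidiag, Finset.sum_mul] at h
  convert h using 2 with a _ a _
  · ring
  · rw [entryMoment]; ring

theorem multinomial_mul_columnMoment {N : ℕ} (i : Fin N) {m : ℕ} {a : Fin N → ℕ}
    (ha : a ∈ Finset.piAntidiag Finset.univ m) :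
    (Nat.multinomial Finset.univ a : ℝ) * columnMoment i a = entryMoment i m := by
  let P : ((Fin N → ℕ) → ℝ) → MvPolynomial (Fin N) ℝ := fun c =>
    ∑ a ∈ Finset.piAntidiag Finset.univ m,
      MvPolynomial.monomial (Finsupp.equivFunOnFinite.symm a) (c a)
  have hcoeff : ∀ c, (P c).coeff (Finsupp.equivFunOnFinite.symm a) = c a := by
    intro c
    simp only [P, MvPolynomial.coeff_sum, MvPolynomial.coeff_monomial,
      EmbeddingLike.apply_eq_iff_eq, Finset.sum_ite_eq', if_pos ha]
  have heval : ∀ c t, MvPolynomial.eval t (P c) =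
      ∑ a ∈ Finset.piAntidiag Finset.univ m, c a * ∏ k, t k ^ a k := by
    intro c t
    simp [P, MvPolynomial.eval_monomial, Finsupp.prod_fintype]
  have hP : P (fun a => (Nat.multinomial Finset.univ a : ℝ) ^ 2 * columnMoment i a) =
      P (fun a => entryMoment i m * Nat.multinomial Finset.univ a) := by
    -- Agreement on the nonnegative orthant, a product of infinite sets, forces equality of
    -- polynomials.
    refine MvPolynomial.funext_set (fun _ => Set.Ici 0) (fun _ => Set.Ici_infinite 0) fun t ht => ?_
    rw [heval, heval]
    exact sum_multinomial_sq_mul_columnMoment i m t fun k => ht k (Set.mem_univ k)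
  have h := hcoeff (fun a => (Nat.multinomial Finset.univ a : ℝ) ^ 2 * columnMoment i a)
  rw [hP, hcoeff] at h
  have hm : (Nat.multinomial Finset.univ a : ℝ) ≠ 0 := by
    exact_mod_cast (Nat.multinomial_pos Finset.univ a).ne'
  apply mul_left_cancel₀ hm
  linear_combination -h

theorem sum_norm_sq_column {N : ℕ} (U : unitaryGroup (Fin N) ℂ) (i : Fin N) :
    ∑ k, ‖(U : Matrix (Fin N) (Fin N) ℂ) k i‖ ^ 2 = 1 := by
  have h := congrFun (congrFun (mem_unitaryGroup_iff'.1 U.2) i) i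
  simp only [Matrix.mul_apply, star_apply, one_apply_eq] at h
  apply Complex.ofReal_injective
  rw [Complex.ofReal_one, ← h, Complex.ofReal_sum]
  refine Finset.sum_congr rfl fun k _ => ?_
  rw [Complex.star_def, Complex.conj_mul', Complex.ofReal_pow]

/-- Integrating the expansion of `1 = (∑ |u_ki|²)^m`, each exponent vector contributes the same
amount, so it suffices to count them. -/
theorem multichoose_mul_entryMoment {N : ℕ} (i : Fin N) (m : ℕ) :
    (N.multichoose m : ℝ) * entryMoment i m = 1 := by
  have h : ∑ a ∈ Finset.piAntidiag (Finset.univ : Finset (Fin N)) m,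
      (Nat.multinomial Finset.univ a : ℝ) * columnMoment i a = 1 := by
    simp only [columnMoment, ← integral_const_mul]
    rw [← integral_finsetSum _ fun a _ => integrable_haarUnitary_of_continuous
      
      (f := fun U => (Nat.multinomial Finset.univ a : ℝ) * ‖columnMonomial i a U‖ ^ 2)
      (continuous_const.mul ((continuous_columnMonomial i a).norm.pow 2))]
    have : ∀ U : unitaryGroup (Fin N) ℂ, ∑ a ∈ Finset.piAntidiag Finset.univ m,
        (Nat.multinomial Finset.univ a : ℝ) * ‖columnMonomial i a U‖ ^ 2 = 1 := by
      intro U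
      rw [← one_pow m, ← sum_norm_sq_column U i, Finset.sum_pow_eq_sum_piAntidiag]
      simp only [columnMonomial, norm_prod, norm_pow, ← Finset.prod_pow, pow_right_comm _ _ 2]
    simp [this]
  rw [Finset.sum_congr rfl fun a ha => multinomial_mul_columnMoment i ha, Finset.sum_const,
    card_piAntidiag_univ_fin, nsmul_eq_mul] at h
  exact h

/-! ### Moments of a COE diagonal entry. -/

theorem multinomial_sq_mul_prod_centralBinom {N n : ℕ} {a : Fin N → ℕ} (ha : ∑ k, a k = n) :
    n.factorial ^ 2 * (Nat.multinomial Finset.univ (2 • a)) * ∏ k, (a k).centralBinom =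
      (2 * n).factorial * Nat.multinomial Finset.univ a ^ 2 := by
  have h1 := Nat.multinomial_spec Finset.univ a
  have h2 := Nat.multinomial_spec Finset.univ (2 • a)
  have h3 : (∏ k, (a k).centralBinom) * (∏ k, (a k).factorial) ^ 2 =
      ∏ k, ((2 • a) k).factorial := by
    rw [← Finset.prod_pow, ← Finset.prod_mul_distrib]
    refine Finset.prod_congr rfl fun k _ => ?_
    have := Nat.choose_mul_factorial_mul_factorial (n := 2 * a k) (k := a k) (by omega)
    rw [Nat.centralBinom, sq, ← mul_assoc, Pi.smul_apply, smul_eq_mul]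
    rwa [show 2 * a k - a k = a k by omega] at this
  simp only [Pi.smul_apply, smul_eq_mul, ← Finset.mul_sum, ha] at h1 h2 h3
  have hp : 0 < ∏ k, (a k).factorial := Finset.prod_pos fun k _ => Nat.factorial_pos _
  rw [← h1, ← h2, ← h3]
  ring

theorem integral_norm_sum_sq_pow {N : ℕ} (i : Fin N) (n : ℕ) :
    ∫ U : unitaryGroup (Fin N) ℂ,
        ‖∑ k, (U : Matrix (Fin N) (Fin N) ℂ) k i ^ 2‖ ^ (2 * n) ∂haarUnitary N =
      (2 ^ n * (n.factorial : ℝ)) / ∏ k ∈ Finset.Icc 1 n, ((N : ℝ) + 2 * (k : ℝ) - 1) := by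
  have hN : 0 < N := i.pos
  have h1 : ∀ U : unitaryGroup (Fin N) ℂ,
      ‖∑ k, (U : Matrix (Fin N) (Fin N) ℂ) k i ^ 2‖ ^ (2 * n) =
      ‖∑ a ∈ Finset.piAntidiag Finset.univ n, (Nat.multinomial Finset.univ a : ℂ) *
        columnMonomial i (2 • a) U‖ ^ 2 := by
    intro U
    rw [mul_comm 2 n, pow_mul, ← norm_pow, Finset.sum_pow_eq_sum_piAntidiag]
    simp only [columnMonomial, Pi.smul_apply, smul_eq_mul, pow_mul]
  have he : Function.Injective fun a : Fin N → ℕ => 2 • a := fun a b h => by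
    ext k
    have := congrFun h k
    simpa using this
  simp only [h1]
  rw [integral_norm_sq_sum_columnMonomial i _ _ he]
  simp only [Complex.norm_natCast]
  have h2 : ((2 * n).factorial : ℝ) * ∑ a ∈ Finset.piAntidiag (Finset.univ : Finset (Fin N)) n,
      (Nat.multinomial Finset.univ a : ℝ) ^ 2 * columnMoment i (2 • a) =
      (n.factorial : ℝ) ^ 2 * entryMoment i (2 * n) *
        ∑ a ∈ Finset.piAntidiag (Finset.univ : Finset (Fin N)) n,
          ∏ k, ((a k).centralBinom : ℝ) := by
    rw [Finset.mul_sum, Finset.mul_sum]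
    refine Finset.sum_congr rfl fun a ha => ?_
    have ha' : ∑ k, a k = n := (Finset.mem_piAntidiag.1 ha).1
    have hc : (n.factorial : ℝ) ^ 2 * (Nat.multinomial Finset.univ (2 • a)) *
        ∏ k, ((a k).centralBinom : ℝ) =
        (2 * n).factorial * (Nat.multinomial Finset.univ a : ℝ) ^ 2 := by
      exact_mod_cast multinomial_sq_mul_prod_centralBinom ha'
    have hm := multinomial_mul_columnMoment i (m := 2 * n) (a := 2 • a) (by
      simp [← Finset.mul_sum, ha'])
    rw [← hm, ← mul_assoc, ← hc]
    ring
  have h3 := multichoose_mul_entryMoment i (2 * n)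
  have h4 := sum_prod_centralBinom N n
  have h5 : ((2 * n).factorial : ℝ) * N.multichoose (2 * n) = N.ascFactorial (2 * n) := by
    exact_mod_cast factorial_mul_multichoose N (2 * n)
  rw [ascFactorial_two_mul_eq] at h5
  have hQ : 0 < ∏ k ∈ Finset.range n, ((N : ℝ) + 2 * k) :=
    Finset.prod_pos fun k _ => by positivity
  have hO : 0 < ∏ k ∈ Finset.Icc 1 n, ((N : ℝ) + 2 * (k : ℝ) - 1) :=
    Finset.prod_pos fun k hk => by
      have : (1 : ℝ) ≤ N := by exact_mod_cast hN
      have : (1 : ℝ) ≤ k := by exact_mod_cast (Finset.mem_Icc.1 hk).1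
      linarith
  rw [eq_div_iff hO.ne']
  generalize (∑ a ∈ Finset.piAntidiag (Finset.univ : Finset (Fin N)) n,
      (Nat.multinomial Finset.univ a : ℝ) ^ 2 * columnMoment i (2 • a)) = x at *
  generalize (∑ a ∈ Finset.piAntidiag (Finset.univ : Finset (Fin N)) n,
      ∏ k, ((a k).centralBinom : ℝ)) = y at *
  generalize (∏ k ∈ Finset.range n, ((N : ℝ) + 2 * k)) = q at *
  generalize (∏ k ∈ Finset.Icc 1 n, ((N : ℝ) + 2 * (k : ℝ) - 1)) = o at *
  -- The product `q` of even-offset factors occurs in both `h4` and `h5`, so the goal is proved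
  -- after multiplying by it.
  apply mul_left_cancel₀ hQ.ne'
  linear_combination (-x) * h5 + N.multichoose (2 * n) * h2 + n.factorial ^ 2 * y * h3
    + n.factorial * h4

end

theorem theorem1p1 {Ω : Type*} [MeasurableSpace Ω] (P : Measure Ω) [IsProbabilityMeasure P]
    (N n : ℕ) (hN : 1 ≤ N) (hn : 1 ≤ n) (V : Ω → Matrix (Fin N) (Fin N) ℂ)
    (hV : HasLaw V (coeLaw N) P) (i : Fin N) :
    Integrable (fun ω => ‖V ω i i‖ ^ (2 * n)) P ∧
      ∫ ω, ‖V ω i i‖ ^ (2 * n) ∂P =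
        (2 ^ n * (n.factorial : ℝ)) / ∏ k ∈ Finset.Icc 1 n, ((N : ℝ) + 2 * (k : ℝ) - 1) := by
  have hc : Continuous fun A : Matrix (Fin N) (Fin N) ℂ => ‖A i i‖ ^ (2 * n) := by fun_prop
  have hm := (measurable_transpose_mul_self N).aemeasurable (μ := haarUnitary N)
  have hentry : ∀ U : unitaryGroup (Fin N) ℂ,
      ((U : Matrix (Fin N) (Fin N) ℂ)ᵀ * (U : Matrix (Fin N) (Fin N) ℂ)) i i =
        ∑ k, (U : Matrix (Fin N) (Fin N) ℂ) k i ^ 2 := fun U => by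
    simp [Matrix.mul_apply, sq]
  constructor
  · have h : Integrable (fun A : Matrix (Fin N) (Fin N) ℂ => ‖A i i‖ ^ (2 * n)) (P.map V) := by
      rw [hV.map_eq, coeLaw, integrable_map_measure hc.measurable.aestronglyMeasurable hm]
      exact integrable_haarUnitary_of_continuous (hc.comp (by fun_prop))
    exact (integrable_map_measure hc.measurable.aestronglyMeasurable hV.aemeasurable).1 h
  · rw [← integral_map hV.aemeasurable
      (f := fun A : Matrix (Fin N) (Fin N) ℂ => ‖A i i‖ ^ (2 * n))
      hc.measurable.aestronglyMeasurable, hV.map_eq, coeLaw,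
      integral_map hm hc.measurable.aestronglyMeasurable]
    simp only [hentry]
    exact integral_norm_sum_sq_pow i n
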